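/- Let $F_n$ be the Fibonacci numbers ($F_1=F_2=1$), $\varphi=(1+\sqrt5)/2$, and let $R_n$ be the number of ways of writing $n\ge 0$ as a sum of distinct Fibonacci numbers $F_i$, $i\ge 2$ (so $R_0=1$). For $k<F_{n-1}$ put $q(k,F_n)=R_k/R_{F_n+k}$. Then there is a function $Q$ on $[0,1/\varphi]$ (clearly unique) such that, whenever $0\le k_n<F_{n-1}$ and $k_n/F_n\to t\in[0,1/\varphi]$ as $n\to\infty$, one has $q(k_n,F_n)\to Q(t)$. The function $Q$ is (weakly) increasing and continuous, and maps $[0,1/\varphi]$ onto $[0,1]$. For every irrational $x\in[0,1]$, with continued fraction $x=[0;c_1,c_2,\dots]=1/(c_1+1/(c_2+1/(c_3+\cdots)))$, the point $$Q^{-1}(x)=\sum_{k=1}^{\infty}\frac{(-1)^{k+1}}{\varphi^{\,2(c_1+c_2+\cdots+c_k)-1}}$$ is the unique $t\in[0,1/\varphi]$ with $Q(t)=x$, the series being convergent; and every inverse of $Q$, that is, every $G:[0,1]\to[0,1/\varphi]$ with $Q(G(y))=y$ for all $y\in[0,1]$, is continuous at $x$ with $G(x)$ equal to this sum. -/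

import Mathlib

open Filter Topology

/-- A Fibonacci representation of `n`: a finite set of indices `i ≥ 2` such that the corresponding
(distinct) Fibonacci numbers `F_i` add up to `n`. The indices start at `2` so that `1 = F_2` is
used at most once. -/
def IsFibRep (n : ℕ) (s : Finset ℕ) : Prop :=
  (∀ i ∈ s, 2 ≤ i) ∧ ∑ i ∈ s, Nat.fib i = n

/-- Every `n` has only finitely many Fibonacci representations. -/
theorem finite_isFibRep (n : ℕ) : {s : Finset ℕ | IsFibRep n s}.Finite := by
  refine Set.Finite.subset (Finset.finite_toSet (Finset.range (n + 2)).powerset) ?_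
  rintro s ⟨-, hs⟩
  simp only [Finset.coe_powerset, Set.mem_preimage, Set.mem_powerset_iff, Finset.coe_subset]
  intro i hi
  have h1 : Nat.fib i ≤ n := by
    rw [← hs]
    exact Finset.single_le_sum (f := fun i => Nat.fib i) (fun _ _ => Nat.zero_le _) hi
  have h2 := Nat.le_fib_add_one i
  rw [Finset.mem_range]
  omega

/-- `R_n`: the number of Fibonacci representations of `n` (so `R_0 = 1`). -/
noncomputable def fibRepCount (n : ℕ) : ℕ :=
  {s : Finset ℕ | IsFibRep n s}.ncard

/-- `q(k, F_n) = R_k / R_{F_n + k}`. -/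
noncomputable def fibRepQuot (k n : ℕ) : ℝ :=
  (fibRepCount k : ℝ) / (fibRepCount (Nat.fib n + k) : ℝ)

/-- `Q` is the limit function on `[0, 1/φ]`: whenever `k_n < F_{n-1}` and `k_n / F_n → x` as
`n → ∞`, one has `q(k_n, F_n) → Q x`. Every `x ∈ [0, 1/φ]` is the limit of such quotients, so that
this determines `Q` on `[0, 1/φ]`. -/
def IsFibBoxFunction (Q : ℝ → ℝ) : Prop :=
  ∀ x ∈ Set.Icc (0 : ℝ) (1 / Real.goldenRatio), ∀ k : ℕ → ℕ,
    (∀ᶠ n in atTop, k n < Nat.fib (n - 1)) →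
    Tendsto (fun n => (k n : ℝ) / (Nat.fib n : ℝ)) atTop (𝓝 x) →
    Tendsto (fun n => fibRepQuot (k n) n) atTop (𝓝 (Q x))

/-- `G` is an inverse of `Q : [0, 1/φ] → [0, 1]`: it maps `[0, 1]` into `[0, 1/φ]` and picks a
preimage under `Q` of every point. (`Q` is constant on some intervals, so there are several.) -/
def IsInverseOfBox (Q G : ℝ → ℝ) : Prop :=
  Set.MapsTo G (Set.Icc 0 1) (Set.Icc 0 (1 / Real.goldenRatio)) ∧
    Set.RightInvOn G Q (Set.Icc 0 1)

/-- `x = [0; c_1, c_2, …]` is the infinite regular continued fraction of `x`, where `c_{i+1}` is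
written `c i`. -/
def HasContFrac (x : ℝ) (c : ℕ → ℕ) : Prop :=
  (GenContFract.of x).h = 0 ∧
    ∀ i, 1 ≤ c i ∧ (GenContFract.of x).partDens.get? i = some (c i : ℝ)

/-- The `k`-th term of the series, `(-1)^(k+1) φ^(-(2(c_1 + ⋯ + c_k) - 1))`, with `k = j + 1`. -/
noncomputable def boxInvTerm (c : ℕ → ℕ) (j : ℕ) : ℝ :=
  (-1) ^ (j + 2) *
    Real.goldenRatio ^ (-(2 * (∑ i ∈ Finset.range (j + 1), (c i : ℤ)) - 1))

/-!
Write `r_j = R_{j-1}` and `r_0 = 0`. Complementation in `{2, …, m}` gives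
`r_{F_{m+1} + j} = r_j + r_{F_m - j}` for `0 ≤ j ≤ F_m` (`shiftedCount_fib_add`). Consequently the
quotient `u_m(j) = r_j / r_{F_{m+1} + j}` has two exact symmetries: `u_m(F_m - j) = 1 - u_m(j)`, and
`u_{m+2}(j) = f(u_m(min j F_m))` for `j ≤ F_{m+1}`, where `f y = y / (1 + y)`
(`boxQuot_fib_sub`, `boxQuot_add_two_min`).

Rescale the variable to `x = j / F_m ∈ [0, 1]`. The second symmetry covers `x < 1/φ`, the first
carries `x > 1/φ²` to this range, and the two ranges overlap. If all quotients near every point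
differ by at most `d`, the symmetries improve the bound to `f d`; since the `n`-th iterate of `f` at
`1` is `1 / (n + 1)`, the quotients are Cauchy at each `x` (`eventually_boxQuot_sub_le`). Their limit
`P` is continuous, and it satisfies `P (1 - x) = 1 - P x` and `P (x / φ²) = f (P x)`. The argument
with `d` and `f d` also shows that `P` is monotone. The box function is `Q t = P (φ t)`.

Combining the two equations, `P (φ^(-2 n) (1 - x / φ²)) = 1 / (n + 1 + P x)`
(`IsBoxLimit.gauss_branch`): an affine contraction on the side of `x` corresponds to prepending a
continued fraction digit on the side of `P x`. The series satisfies the same affine recursion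
(`tsum_boxInvTerm`), so a point with irrational value and `φ` times the sum of the series for that
value differ by `O(φ^(-2 n))` for every `n` (`IsBoxLimit.eq_tsum_boxInvTerm`). This determines the
preimage of an irrational number, and continuity of inverses there follows by compactness.
-/

open scoped goldenRatio

/-! ### Counting representations -/

theorem IsFibRep.lt_of_lt_fib {n m : ℕ} {s : Finset ℕ} (hs : IsFibRep n s) (hn : n < Nat.fib m)
    {i : ℕ} (hi : i ∈ s) : i < m := by
  by_contra! h
  have h1 : Nat.fib i ≤ n := by
    rw [← hs.2]
    exact Finset.single_le_sum (f := fun i => Nat.fib i) (fun _ _ => Nat.zero_le _) hi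
  have h2 := Nat.fib_mono h
  omega

theorem sum_Icc_fib_add_two (m : ℕ) (hm : 1 ≤ m) :
    ∑ i ∈ Finset.Icc 2 m, Nat.fib i + 2 = Nat.fib (m + 2) := by
  induction m, hm using Nat.le_induction with
  | base => decide
  | succ m hm ih =>
    rw [Finset.sum_Icc_succ_top (by omega), Nat.fib_add_two (n := m + 1), ← ih]
    ring

/-- The representations of `F_{m+1} + k` that use `F_{m+1}` are those of `k` with `F_{m+1}`
added. -/
theorem fibRepCount_fib_add {m k : ℕ} (hm : 1 ≤ m) (hk : k < Nat.fib m) :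
    fibRepCount (Nat.fib (m + 1) + k) = fibRepCount k +
      {s : Finset ℕ | IsFibRep (Nat.fib (m + 1) + k) s ∧ m + 1 ∉ s}.ncard := by
  have hmem : ∀ s, IsFibRep k s → m + 1 ∉ s := fun s hs h => by
    have := hs.lt_of_lt_fib hk h
    omega
  have himg : {s : Finset ℕ | IsFibRep (Nat.fib (m + 1) + k) s} =
      insert (m + 1) '' {s : Finset ℕ | IsFibRep k s} ∪
        {s : Finset ℕ | IsFibRep (Nat.fib (m + 1) + k) s ∧ m + 1 ∉ s} := by
    ext s
    simp only [Set.mem_ofPred_eq, Set.mem_union, Set.mem_image]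
    constructor
    · intro hs
      by_cases h : m + 1 ∈ s
      · refine Or.inl ⟨s.erase (m + 1), ⟨fun i hi => hs.1 i (Finset.mem_of_mem_erase hi), ?_⟩,
          Finset.insert_erase h⟩
        have h1 := Finset.add_sum_erase s (fun i => Nat.fib i) h
        have h2 := hs.2
        omega
      · exact Or.inr ⟨hs, h⟩
    · rintro (⟨t, ht, rfl⟩ | h)
      · refine ⟨fun i hi => ?_, ?_⟩
        · rcases Finset.mem_insert.1 hi with rfl | hi
          · omega
          · exact ht.1 i hi
        · rw [Finset.sum_insert (hmem t ht), ht.2]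
      · exact h.1
  unfold fibRepCount
  rw [himg, Set.ncard_union_eq ?_ ((finite_isFibRep k).image _)
    ((finite_isFibRep _).subset fun s hs => hs.1), Set.InjOn.ncard_image]
  · intro s hs t ht hst
    rw [← Finset.erase_insert (hmem s hs), ← Finset.erase_insert (hmem t ht)]
    exact congrArg (fun s => Finset.erase s (m + 1)) hst
  · rw [Set.disjoint_left]
    rintro _ ⟨t, -, rfl⟩ h
    exact h.2 (Finset.mem_insert_self _ _)

theorem IsFibRep.subset_Icc {m k : ℕ} (hk : k < Nat.fib m) {s : Finset ℕ}
    (hs : IsFibRep (Nat.fib (m + 1) + k) s) (h : m + 1 ∉ s) : s ⊆ Finset.Icc 2 m := by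
  intro i hi
  have h1 : i < m + 2 := hs.lt_of_lt_fib (by rw [Nat.fib_add_two]; omega) hi
  have h2 : i ≠ m + 1 := fun e => h (e ▸ hi)
  have h3 := hs.1 i hi
  rw [Finset.mem_Icc]
  omega

/-- Complementation in `{2, …, m}`, whose Fibonacci numbers add up to `F_{m+2} - 2`, turns the
representations of `F_{m+1} + k` without `F_{m+1}` into those of `F_m - 2 - k`. -/
theorem ncard_isFibRep_not_mem {m k l : ℕ} (hm : 1 ≤ m) (hkl : k + l + 2 = Nat.fib m) :
    {s : Finset ℕ | IsFibRep (Nat.fib (m + 1) + k) s ∧ m + 1 ∉ s}.ncard = fibRepCount l := by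
  have hsum := sum_Icc_fib_add_two m hm
  rw [Nat.fib_add_two] at hsum
  have hsub : ∀ s, IsFibRep l s → s ⊆ Finset.Icc 2 m := fun s hs i hi => by
    have h1 := hs.lt_of_lt_fib (m := m) (by omega) hi
    have h2 := hs.1 i hi
    rw [Finset.mem_Icc]
    omega
  have himg : {s : Finset ℕ | IsFibRep (Nat.fib (m + 1) + k) s ∧ m + 1 ∉ s} =
      (Finset.Icc 2 m \ ·) '' {s : Finset ℕ | IsFibRep l s} := by
    ext s
    simp only [Set.mem_ofPred_eq, Set.mem_image]
    constructor
    · rintro ⟨hs, h⟩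
      have hss := hs.subset_Icc (by omega) h
      refine ⟨Finset.Icc 2 m \ s, ⟨fun i hi => ?_, ?_⟩, Finset.sdiff_sdiff_eq_self hss⟩
      · exact (Finset.mem_Icc.1 (Finset.mem_sdiff.1 hi).1).1
      · have h1 := Finset.sum_sdiff (f := fun i => Nat.fib i) hss
        have h2 := hs.2
        omega
    · rintro ⟨t, ht, rfl⟩
      refine ⟨⟨fun i hi => ?_, ?_⟩, fun h => ?_⟩
      · exact (Finset.mem_Icc.1 (Finset.mem_sdiff.1 hi).1).1
      · have h1 := Finset.sum_sdiff (f := fun i => Nat.fib i) (hsub t ht)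
        have h2 := ht.2
        omega
      · have := (Finset.mem_Icc.1 (Finset.mem_sdiff.1 h).1).2
        omega
  rw [himg, Set.InjOn.ncard_image, fibRepCount]
  intro s hs t ht hst
  rw [← Finset.sdiff_sdiff_eq_self (hsub s hs), ← Finset.sdiff_sdiff_eq_self (hsub t ht)]
  exact congrArg (Finset.Icc 2 m \ ·) hst

theorem ncard_isFibRep_not_mem_eq_zero {m k : ℕ} (hm : 1 ≤ m) (hk : k + 1 = Nat.fib m) :
    {s : Finset ℕ | IsFibRep (Nat.fib (m + 1) + k) s ∧ m + 1 ∉ s}.ncard = 0 := by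
  have hsum := sum_Icc_fib_add_two m hm
  rw [Nat.fib_add_two] at hsum
  rw [Set.ncard_eq_zero ((finite_isFibRep _).subset fun s hs => hs.1), Set.eq_empty_iff_forall_notMem]
  rintro s ⟨hs, h⟩
  have hss := hs.subset_Icc (by omega) h
  have h1 := Finset.sum_sdiff (f := fun i => Nat.fib i) hss
  have h2 := hs.2
  omega

theorem fibRepCount_zero : fibRepCount 0 = 1 := by
  have : {s : Finset ℕ | IsFibRep 0 s} = {∅} := by
    ext s
    simp only [Set.mem_ofPred_eq, Set.mem_singleton_iff]
    constructor
    · intro hs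
      refine Finset.eq_empty_of_forall_notMem fun i hi => ?_
      have h1 := hs.lt_of_lt_fib (m := 1) (by simp) hi
      have h2 := hs.1 i hi
      omega
    · rintro rfl
      simp [IsFibRep]
  rw [fibRepCount, this, Set.ncard_singleton]

/-- The count with its argument shifted by one, `r_j = R_{j-1}`, with `r_0 = 0`. In this
normalization the complementation symmetry `j ↦ F_m - j` needs no correction term and includes the
endpoints. -/
noncomputable def shiftedCount : ℕ → ℕ
  | 0 => 0
  | k + 1 => fibRepCount k

theorem shiftedCount_fib {m : ℕ} (hm : 1 ≤ m) : shiftedCount (Nat.fib m) = 1 := by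
  induction m using Nat.strong_induction_on with
  | _ m ih =>
    match m with
    | 0 => omega
    | 1 => exact fibRepCount_zero
    | 2 => exact fibRepCount_zero
    | m + 3 =>
      have hpos := Nat.fib_pos.2 (show 0 < m + 1 by omega)
      obtain ⟨k, hk⟩ := Nat.exists_eq_add_of_lt hpos
      rw [zero_add] at hk
      have h := ih (m + 1) (by omega) (by omega)
      rw [hk] at h
      rw [Nat.fib_add_two (n := m + 1), hk, add_comm, ← add_assoc]
      change fibRepCount _ = 1
      rw [fibRepCount_fib_add (by omega) (by omega),
        ncard_isFibRep_not_mem_eq_zero (by omega) hk.symm]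
      exact h

/-- The recursion that governs everything: the representations of `F_{m+1} + j - 1` with and
without `F_{m+1}`. -/
theorem shiftedCount_fib_add {m j : ℕ} (hm : 1 ≤ m) (hj : j ≤ Nat.fib m) :
    shiftedCount (Nat.fib (m + 1) + j) = shiftedCount j + shiftedCount (Nat.fib m - j) := by
  match j with
  | 0 =>
    rw [add_zero, Nat.sub_zero, shiftedCount_fib hm, shiftedCount_fib (by omega)]
    rfl
  | k + 1 =>
    change fibRepCount (Nat.fib (m + 1) + k) = fibRepCount k + _
    rw [fibRepCount_fib_add hm (by omega)]
    congr 1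
    rcases Nat.lt_or_ge (k + 1) (Nat.fib m) with h | h
    · obtain ⟨l, hl⟩ := Nat.exists_eq_add_of_lt h
      rw [ncard_isFibRep_not_mem hm (l := l) (by omega),
        show Nat.fib m - (k + 1) = l + 1 by omega]
      rfl
    · rw [ncard_isFibRep_not_mem_eq_zero hm (by omega), show Nat.fib m - (k + 1) = 0 by omega]
      rfl

theorem shiftedCount_fib_add_sub {m j : ℕ} (hm : 1 ≤ m) (hj : j ≤ Nat.fib m) :
    shiftedCount (Nat.fib (m + 1) + (Nat.fib m - j)) = shiftedCount (Nat.fib (m + 1) + j) := by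
  rw [shiftedCount_fib_add hm hj, shiftedCount_fib_add hm (Nat.sub_le _ _), Nat.sub_sub_self hj,
    add_comm]

theorem shiftedCount_pos {j : ℕ} (hj : 0 < j) : 0 < shiftedCount j := by
  induction j using Nat.strong_induction_on with
  | _ j ih =>
    rcases Nat.lt_or_ge 1 j with h | h
    · -- the largest Fibonacci number `F_{m+1} ≤ j`
      obtain ⟨m, hm1, hm2, hm3⟩ : ∃ m, 1 ≤ m ∧ Nat.fib (m + 1) ≤ j ∧ j < Nat.fib (m + 2) := by
        have h2 := Nat.fib_greatestFib_le j
        have h3 := Nat.lt_fib_greatestFib_add_one j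
        have h4 : 2 ≤ Nat.greatestFib j := Nat.le_greatestFib.2 (by simp; omega)
        obtain ⟨m, hm⟩ := Nat.exists_eq_add_of_le h4
        rw [hm] at h2 h3
        exact ⟨m + 1, by omega, by rwa [add_comm 2 m] at h2, by
          rwa [show 2 + m + 1 = m + 1 + 2 by ring] at h3⟩
      rw [Nat.fib_add_two] at hm3
      obtain ⟨i, rfl⟩ := Nat.exists_eq_add_of_le hm2
      have hp := Nat.fib_pos.2 (show 0 < m + 1 by omega)
      rcases Nat.eq_zero_or_pos i with rfl | hi
      · rw [add_zero, shiftedCount_fib (by omega)]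
        exact Nat.one_pos
      · rw [shiftedCount_fib_add hm1 (by omega)]
        exact Nat.add_pos_left (ih i (by omega) hi) _
    · obtain rfl : j = 1 := by omega
      rw [show (1 : ℕ) = Nat.fib 1 from rfl, shiftedCount_fib le_rfl]
      exact Nat.one_pos

/-! ### The quotients and their two symmetries -/

/-- The quotient `q(j - 1, F_{m+1}) = R_{j-1} / R_{F_{m+1}+j-1}`, extended by `0` to `j = 0`; it is
used for `0 ≤ j ≤ F_m`. -/
noncomputable def boxQuot (m j : ℕ) : ℝ :=
  (shiftedCount j : ℝ) / (shiftedCount (Nat.fib (m + 1) + j) : ℝ)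

theorem fibRepQuot_succ (m k : ℕ) : fibRepQuot k (m + 1) = boxQuot m (k + 1) := rfl

theorem boxQuot_eq {m j : ℕ} (hm : 1 ≤ m) (hj : j ≤ Nat.fib m) :
    boxQuot m j = (shiftedCount j : ℝ) / (shiftedCount j + shiftedCount (Nat.fib m - j)) := by
  rw [boxQuot, shiftedCount_fib_add hm hj, Nat.cast_add]

theorem boxQuot_nonneg (m j : ℕ) : 0 ≤ boxQuot m j := by unfold boxQuot; positivity

theorem shiftedCount_fib_add_cast_pos (m j : ℕ) :
    (0 : ℝ) < shiftedCount (Nat.fib (m + 1) + j) :=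
  Nat.cast_pos.2 (shiftedCount_pos (Nat.add_pos_left (Nat.fib_pos.2 m.succ_pos) _))

theorem boxQuot_le_one {m j : ℕ} (hm : 1 ≤ m) (hj : j ≤ Nat.fib m) : boxQuot m j ≤ 1 := by
  rw [boxQuot, div_le_one (shiftedCount_fib_add_cast_pos m j), Nat.cast_le,
    shiftedCount_fib_add hm hj]
  exact Nat.le_add_right _ _

theorem boxQuot_fib_sub {m j : ℕ} (hm : 1 ≤ m) (hj : j ≤ Nat.fib m) :
    boxQuot m (Nat.fib m - j) = 1 - boxQuot m j := by
  have hp := shiftedCount_fib_add_cast_pos m j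
  rw [boxQuot, boxQuot, shiftedCount_fib_add_sub hm hj, eq_sub_iff_add_eq, ← add_div,
    div_eq_one_iff_eq hp.ne', shiftedCount_fib_add hm hj, Nat.cast_add, add_comm]

theorem boxQuot_fib {m : ℕ} (hm : 1 ≤ m) : boxQuot m (Nat.fib m) = 1 := by
  rw [boxQuot_eq hm le_rfl, Nat.sub_self, shiftedCount_fib hm]
  simp [shiftedCount]

theorem boxQuot_add_two {m j : ℕ} (hm : 1 ≤ m) (hj : j ≤ Nat.fib m) :
    boxQuot (m + 2) j = boxQuot m j / (1 + boxQuot m j) := by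
  have hp := shiftedCount_fib_add_cast_pos m j
  have h : shiftedCount (Nat.fib (m + 2) - j) = shiftedCount (Nat.fib (m + 1) + j) := by
    rw [← shiftedCount_fib_add_sub hm hj, Nat.fib_add_two]
    congr 1
    omega
  have hle : Nat.fib m ≤ Nat.fib (m + 2) := Nat.fib_mono (by omega)
  rw [boxQuot_eq (by omega) (hj.trans hle), h, boxQuot]
  field_simp
  rw [add_comm]

theorem boxQuot_add_two_middle {m j : ℕ} (hm : 2 ≤ m) (hj : Nat.fib m ≤ j)
    (hj' : j ≤ Nat.fib (m + 1)) : boxQuot (m + 2) j = 1 / 2 := by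
  obtain ⟨n, rfl⟩ := Nat.exists_eq_add_of_le' hm
  obtain ⟨i, rfl⟩ := Nat.exists_eq_add_of_le hj
  have h1 : Nat.fib (n + 3) = Nat.fib (n + 1) + Nat.fib (n + 2) := Nat.fib_add_two
  have h2 : Nat.fib (n + 4) = Nat.fib (n + 2) + Nat.fib (n + 3) := Nat.fib_add_two
  have hi : i ≤ Nat.fib (n + 1) := by
    rw [show n + 2 + 1 = n + 3 from rfl] at hj'
    omega
  have h : shiftedCount (Nat.fib (n + 2 + 2) - (Nat.fib (n + 2) + i)) =
      shiftedCount (Nat.fib (n + 2) + i) := by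
    rw [← shiftedCount_fib_add_sub (by omega) hi]
    congr 1
    rw [show n + 2 + 2 = n + 4 from rfl, show n + 1 + 1 = n + 2 from rfl]
    omega
  have hp : (0 : ℝ) < shiftedCount (Nat.fib (n + 2) + i) := shiftedCount_fib_add_cast_pos (n + 1) i
  rw [boxQuot_eq (by omega) (by rw [show n + 2 + 2 = n + 4 from rfl]; omega), h]
  field_simp
  norm_num

/-- The scaling symmetry. On the plateau `F_m ≤ j ≤ F_{m+1}` the quotient is `1 / 2`, which is also
its value at `j = F_m`; hence the truncation. -/
theorem boxQuot_add_two_min {m j : ℕ} (hm : 2 ≤ m) (hj : j ≤ Nat.fib (m + 1)) :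
    boxQuot (m + 2) j =
      boxQuot m (min j (Nat.fib m)) / (1 + boxQuot m (min j (Nat.fib m))) := by
  rcases le_total j (Nat.fib m) with h | h
  · rw [min_eq_left h, boxQuot_add_two (by omega) h]
  · rw [min_eq_right h, boxQuot_fib (by omega), boxQuot_add_two_middle hm h hj]
    norm_num

/-! ### The limit of the quotients -/

/-- The filter of pairs `(m, j)` with `m → ∞`, `j ≤ F_m` and `j / F_m → x`. -/
noncomputable def boxFilter (x : ℝ) : Filter (ℕ × ℕ) :=
  comap Prod.fst atTop ⊓ 𝓟 {p | p.2 ≤ Nat.fib p.1} ⊓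
    comap (fun p => (p.2 : ℝ) / (Nat.fib p.1 : ℝ)) (𝓝 x)

theorem tendsto_boxFilter_iff {ι : Type*} {l : Filter ι} {f : ι → ℕ × ℕ} {x : ℝ} :
    Tendsto f l (boxFilter x) ↔ Tendsto (fun i => (f i).1) l atTop ∧
      (∀ᶠ i in l, (f i).2 ≤ Nat.fib (f i).1) ∧
      Tendsto (fun i => ((f i).2 : ℝ) / (Nat.fib (f i).1 : ℝ)) l (𝓝 x) := by
  rw [boxFilter, tendsto_inf, tendsto_inf, tendsto_comap_iff, tendsto_comap_iff, tendsto_principal,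
    and_assoc]
  rfl

theorem boxFilter_spec (x : ℝ) : Tendsto (fun p : ℕ × ℕ => p.1) (boxFilter x) atTop ∧
      (∀ᶠ p in boxFilter x, p.2 ≤ Nat.fib p.1) ∧
      Tendsto (fun p : ℕ × ℕ => (p.2 : ℝ) / (Nat.fib p.1 : ℝ)) (boxFilter x) (𝓝 x) :=
  tendsto_boxFilter_iff.1 tendsto_id

theorem tendsto_cast_fib_atTop : Tendsto (fun n => (Nat.fib n : ℝ)) atTop atTop := by
  refine tendsto_natCast_atTop_atTop.comp ((tendsto_add_atTop_iff_nat 2).1 ?_)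
  exact Nat.fib_add_two_strictMono.tendsto_atTop

theorem tendsto_floor_mul_fib {x : ℝ} (hx : 0 ≤ x) :
    Tendsto (fun n => (⌊x * Nat.fib n⌋₊ : ℝ) / (Nat.fib n : ℝ)) atTop (𝓝 x) :=
  (tendsto_nat_floor_mul_div_atTop hx).comp tendsto_cast_fib_atTop

theorem floor_mul_fib_le {x : ℝ} (hx : x ≤ 1) (n : ℕ) : ⌊x * Nat.fib n⌋₊ ≤ Nat.fib n :=
  Nat.floor_le_of_le (mul_le_of_le_one_left (Nat.cast_nonneg _) hx)

theorem boxFilter_neBot {x : ℝ} (hx : x ∈ Set.Icc (0 : ℝ) 1) : (boxFilter x).NeBot := by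
  have h : Tendsto (fun n => (n, ⌊x * Nat.fib n⌋₊)) atTop (boxFilter x) :=
    tendsto_boxFilter_iff.2 ⟨tendsto_id, Eventually.of_forall (floor_mul_fib_le hx.2),
      tendsto_floor_mul_fib hx.1⟩
  exact h.neBot

theorem tendsto_boxFilter_reflect (x : ℝ) :
    Tendsto (fun p : ℕ × ℕ => (p.1, Nat.fib p.1 - p.2)) (boxFilter x) (boxFilter (1 - x)) := by
  obtain ⟨h1, h2, h3⟩ := boxFilter_spec x
  refine tendsto_boxFilter_iff.2 ⟨h1, Eventually.of_forall fun p => Nat.sub_le _ _, ?_⟩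
  refine (h3.const_sub 1).congr' ?_
  filter_upwards [h2, h1.eventually_ge_atTop 1] with p hp hp1
  have : (0 : ℝ) < Nat.fib p.1 := Nat.cast_pos.2 (Nat.fib_pos.2 hp1)
  rw [Nat.cast_sub hp, sub_div, div_self this.ne']

theorem tendsto_fib_pred_div_fib :
    Tendsto (fun n => (Nat.fib (n - 1) : ℝ) / (Nat.fib n : ℝ)) atTop (𝓝 φ⁻¹) := by
  rw [← tendsto_add_atTop_iff_nat 1]
  rw [Real.inv_goldenRatio]
  exact tendsto_fib_div_fib_succ_atTop

theorem tendsto_fib_div_fib_sub_two :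
    Tendsto (fun n => (Nat.fib n : ℝ) / (Nat.fib (n - 2) : ℝ)) atTop (𝓝 (φ ^ 2)) := by
  rw [← tendsto_add_atTop_iff_nat 2, sq]
  have h := tendsto_fib_succ_div_fib_atTop
  refine (((tendsto_add_atTop_iff_nat 1).2 h).mul h).congr fun n => ?_
  have : (0 : ℝ) < Nat.fib (n + 1) := Nat.cast_pos.2 (Nat.fib_pos.2 n.succ_pos)
  rw [Nat.add_sub_cancel, div_mul_div_cancel₀ this.ne']

theorem eventually_le_fib_pred {x : ℝ} (hx : x < φ⁻¹) :
    ∀ᶠ p in boxFilter x, p.2 ≤ Nat.fib (p.1 - 1) := by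
  obtain ⟨h1, h2, h3⟩ := boxFilter_spec x
  filter_upwards [h3.eventually_lt (tendsto_fib_pred_div_fib.comp h1) hx,
    h1.eventually_ge_atTop 1] with p hp hp1
  have : (0 : ℝ) < Nat.fib p.1 := Nat.cast_pos.2 (Nat.fib_pos.2 hp1)
  exact_mod_cast ((div_lt_div_iff_of_pos_right this).1 hp).le

theorem tendsto_boxFilter_shift (x : ℝ) :
    Tendsto (fun p : ℕ × ℕ => (p.1 - 2, min p.2 (Nat.fib (p.1 - 2)))) (boxFilter x)
      (boxFilter (min (φ ^ 2 * x) 1)) := by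
  obtain ⟨h1, h2, h3⟩ := boxFilter_spec x
  refine tendsto_boxFilter_iff.2 ⟨(tendsto_sub_atTop_nat 2).comp h1,
    Eventually.of_forall fun p => min_le_right _ _, ?_⟩
  refine (((tendsto_fib_div_fib_sub_two.comp h1).mul h3).min tendsto_const_nhds).congr' ?_
  filter_upwards [h1.eventually_ge_atTop 3] with p hp
  have h4 : (0 : ℝ) < Nat.fib p.1 := Nat.cast_pos.2 (Nat.fib_pos.2 (by omega))
  have h5 : (0 : ℝ) < Nat.fib (p.1 - 2) := Nat.cast_pos.2 (Nat.fib_pos.2 (by omega))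
  rw [Function.comp_apply, Nat.cast_min, ← min_div_div_right h5.le, div_self h5.ne',
    div_mul_div_cancel₀' h4.ne']

/-- The generator of the Farey tree that carries `[0, 1]` onto `[0, 1/2]`. -/
noncomputable def fareyLeft (y : ℝ) : ℝ := y / (1 + y)

theorem eventually_boxQuot_reflect (x : ℝ) : ∀ᶠ p in boxFilter x,
    boxQuot p.1 (Nat.fib p.1 - p.2) = 1 - boxQuot p.1 p.2 := by
  obtain ⟨h1, h2, h3⟩ := boxFilter_spec x
  filter_upwards [h1.eventually_ge_atTop 1, h2] with p hp hp2 using boxQuot_fib_sub hp hp2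

theorem eventually_boxQuot_shift {x : ℝ} (hx : x < φ⁻¹) : ∀ᶠ p in boxFilter x,
    boxQuot p.1 p.2 = fareyLeft (boxQuot (p.1 - 2) (min p.2 (Nat.fib (p.1 - 2)))) := by
  filter_upwards [(boxFilter_spec x).1.eventually_ge_atTop 4, eventually_le_fib_pred hx] with p hp hp2
  obtain ⟨n, hn⟩ := Nat.exists_eq_add_of_le' (show 2 ≤ p.1 by omega)
  rw [hn] at hp2 ⊢
  exact boxQuot_add_two_min (by omega) hp2

theorem fareyLeft_sub_le {a b d : ℝ} (ha : 0 ≤ a) (hb : 0 ≤ b) (hd : 0 ≤ d) (h : a - b ≤ d) :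
    fareyLeft a - fareyLeft b ≤ fareyLeft d := by
  unfold fareyLeft
  rw [div_sub_div _ _ (by positivity) (by positivity), div_le_div_iff₀ (by positivity) (by positivity)]
  nlinarith [mul_nonneg ha hb, mul_nonneg hd ha, mul_nonneg hd hb,
    mul_nonneg (mul_nonneg ha hb) hd]

/-- The orbit of `1` under `y ↦ y / (1 + y)` is `1 / (n + 1)`, so a bound that may be replaced by
its image under this map can be made arbitrarily small. This takes the place of a contraction constant: the
derivative of the map at `0` is `1`. -/
theorem fareyLeft_induction {H : ℝ → Prop} (h1 : H 1)
    (hstep : ∀ d, 0 ≤ d → H d → H (fareyLeft d)) {ε : ℝ} (hε : 0 < ε) : ∃ d, d < ε ∧ H d := by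
  have h : ∀ n : ℕ, H (1 / ((n : ℝ) + 1)) := fun n => by
    induction n with
    | zero => simpa using h1
    | succ n ih =>
      have := hstep _ (by positivity) ih
      have e : fareyLeft (1 / ((n : ℝ) + 1)) = 1 / (((n + 1 : ℕ) : ℝ) + 1) := by
        unfold fareyLeft
        push_cast
        field_simp
      rwa [e] at this
  obtain ⟨n, hn⟩ := exists_nat_one_div_lt hε
  exact ⟨_, hn, h n⟩

theorem inv_goldenRatio_add_sq : φ⁻¹ + (φ ^ 2)⁻¹ = 1 := by
  rw [← inv_pow, Real.inv_goldenRatio, neg_sq, Real.goldenConj_sq]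
  ring

theorem inv_goldenRatio_sq_lt : (φ ^ 2)⁻¹ < φ⁻¹ := by
  have h1 := Real.one_lt_goldenRatio
  rw [inv_lt_inv₀ (by positivity) (by positivity)]
  nlinarith

theorem min_mul_mem_Icc {x : ℝ} (hx : 0 ≤ x) : min (φ ^ 2 * x) 1 ∈ Set.Icc (0 : ℝ) 1 :=
  ⟨le_min (by positivity) zero_le_one, min_le_right _ _⟩

/-- The oscillation of the quotients at every point is at most `d`, for arbitrarily small `d`. The
two symmetries reduce the oscillation at `x` to the oscillation at another point. -/
theorem eventually_boxQuot_sub_le {ε : ℝ} (hε : 0 < ε) : ∀ x ∈ Set.Icc (0 : ℝ) 1,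
    ∀ᶠ p in boxFilter x ×ˢ boxFilter x, |boxQuot p.1.1 p.1.2 - boxQuot p.2.1 p.2.2| < ε := by
  suffices h : ∃ d, d < ε ∧ ∀ x ∈ Set.Icc (0 : ℝ) 1,
      ∀ᶠ p in boxFilter x ×ˢ boxFilter x, |boxQuot p.1.1 p.1.2 - boxQuot p.2.1 p.2.2| ≤ d by
    obtain ⟨d, hdε, hd⟩ := h
    intro x hx
    filter_upwards [hd x hx] with p hp using hp.trans_lt hdε
  refine fareyLeft_induction ?_ ?_ hε
  · intro x hx
    obtain ⟨h1, h2, h3⟩ := boxFilter_spec x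
    have h : ∀ᶠ p in boxFilter x, 0 ≤ boxQuot p.1 p.2 ∧ boxQuot p.1 p.2 ≤ 1 := by
      filter_upwards [h1.eventually_ge_atTop 1, h2] with p hp hp2
        using ⟨boxQuot_nonneg _ _, boxQuot_le_one hp hp2⟩
    filter_upwards [h.prod_inl (boxFilter x), h.prod_inr (boxFilter x)] with p hp hp'
    rw [abs_sub_le_iff]
    constructor <;> linarith [hp.1, hp.2, hp'.1, hp'.2]
  · intro d hd0 hd
    have key : ∀ x ∈ Set.Icc (0 : ℝ) 1, x < φ⁻¹ → ∀ᶠ p in boxFilter x ×ˢ boxFilter x,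
        |boxQuot p.1.1 p.1.2 - boxQuot p.2.1 p.2.2| ≤ fareyLeft d := by
      intro x hx hxφ
      have hs := tendsto_boxFilter_shift x
      have he := eventually_boxQuot_shift hxφ
      filter_upwards [(hs.prodMap hs).eventually (hd _ (min_mul_mem_Icc hx.1)),
        he.prod_inl (boxFilter x), he.prod_inr (boxFilter x)] with p hp hp1 hp2
      simp only [Prod.map_fst, Prod.map_snd] at hp
      rw [hp1, hp2]
      rw [abs_sub_le_iff] at hp ⊢
      exact ⟨fareyLeft_sub_le (boxQuot_nonneg _ _) (boxQuot_nonneg _ _) hd0 hp.1,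
        fareyLeft_sub_le (boxQuot_nonneg _ _) (boxQuot_nonneg _ _) hd0 hp.2⟩
    intro x hx
    rcases lt_or_ge x φ⁻¹ with h | h
    · exact key x hx h
    · have hr := tendsto_boxFilter_reflect x
      have he := eventually_boxQuot_reflect x
      have hlt : 1 - x < φ⁻¹ := by linarith [inv_goldenRatio_add_sq, inv_goldenRatio_sq_lt]
      filter_upwards [(hr.prodMap hr).eventually
        (key (1 - x) ⟨by linarith [hx.2], by linarith [hx.1]⟩ hlt),
        he.prod_inl (boxFilter x), he.prod_inr (boxFilter x)] with p hp hp1 hp2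
      simp only [Prod.map_fst, Prod.map_snd] at hp
      rw [hp1, hp2, sub_sub_sub_cancel_left, abs_sub_comm] at hp
      exact hp

/-- `P : [0, 1] → ℝ` is the limit function of the quotients, with `j / F_m` as its variable. -/
def IsBoxLimit (P : ℝ → ℝ) : Prop :=
  ∀ x ∈ Set.Icc (0 : ℝ) 1, Tendsto (fun p : ℕ × ℕ => boxQuot p.1 p.2) (boxFilter x) (𝓝 (P x))

theorem exists_isBoxLimit : ∃ P : ℝ → ℝ, IsBoxLimit P := by
  have h : ∀ x : ℝ, ∃ y : ℝ, x ∈ Set.Icc (0 : ℝ) 1 →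
      Tendsto (fun p : ℕ × ℕ => boxQuot p.1 p.2) (boxFilter x) (𝓝 y) := by
    intro x
    by_cases hx : x ∈ Set.Icc (0 : ℝ) 1
    · have := boxFilter_neBot hx
      have hc : Cauchy (map (fun p : ℕ × ℕ => boxQuot p.1 p.2) (boxFilter x)) := by
        rw [cauchy_map_iff', Metric.uniformity_basis_dist.tendsto_right_iff]
        exact fun ε hε => eventually_boxQuot_sub_le hε x hx
      obtain ⟨y, hy⟩ := CompleteSpace.complete hc
      exact ⟨y, fun _ => hy⟩
    · exact ⟨0, fun h => absurd h hx⟩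
  choose P hP using h
  exact ⟨P, fun x hx => hP x hx⟩

theorem IsBoxLimit.continuousOn {P : ℝ → ℝ} (hP : IsBoxLimit P) :
    ContinuousOn P (Set.Icc 0 1) := by
  intro x hx
  rw [ContinuousWithinAt, (Metric.nhds_basis_closedBall).tendsto_right_iff]
  intro ε hε
  have h := (hP x hx).eventually (Metric.closedBall_mem_nhds _ hε)
  rw [boxFilter, eventually_inf] at h
  obtain ⟨s, hs, t, ht, hst⟩ := h
  obtain ⟨u, hu, hut⟩ := mem_comap.1 ht
  obtain ⟨v, hvu, hvo, hxv⟩ := mem_nhds_iff.1 hu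
  filter_upwards [mem_nhdsWithin_of_mem_nhds (hvo.mem_nhds hxv), self_mem_nhdsWithin] with y hyv hy
  have := boxFilter_neBot hy
  refine Metric.isClosed_closedBall.mem_of_tendsto (hP y hy) ?_
  have h1 : s ∈ boxFilter y := mem_inf_of_left hs
  have h2 : t ∈ boxFilter y :=
    mem_inf_of_right (mem_comap.2 ⟨v, hvo.mem_nhds hyv, (Set.preimage_mono hvu).trans hut⟩)
  filter_upwards [h1, h2] with p hp1 hp2 using hst p ⟨hp1, hp2⟩

/-! ### Functional equations of the limit -/

namespace IsBoxLimit

variable {P : ℝ → ℝ}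

theorem mem_Icc (hP : IsBoxLimit P) {x : ℝ} (hx : x ∈ Set.Icc (0 : ℝ) 1) :
    P x ∈ Set.Icc (0 : ℝ) 1 := by
  have := boxFilter_neBot hx
  obtain ⟨h1, h2, h3⟩ := boxFilter_spec x
  refine isClosed_Icc.mem_of_tendsto (hP x hx) ?_
  filter_upwards [h1.eventually_ge_atTop 1, h2] with p hp hp2
    using ⟨boxQuot_nonneg _ _, boxQuot_le_one hp hp2⟩

theorem one_sub (hP : IsBoxLimit P) {x : ℝ} (hx : x ∈ Set.Icc (0 : ℝ) 1) :
    P (1 - x) = 1 - P x := by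
  have := boxFilter_neBot hx
  have h1 := (hP (1 - x) ⟨by linarith [hx.2], by linarith [hx.1]⟩).comp (tendsto_boxFilter_reflect x)
  exact tendsto_nhds_unique (h1.congr' (eventually_boxQuot_reflect x)) ((hP x hx).const_sub 1)

theorem eq_fareyLeft (hP : IsBoxLimit P) {x : ℝ} (hx : x ∈ Set.Icc (0 : ℝ) 1) (hxφ : x < φ⁻¹) :
    P x = fareyLeft (P (min (φ ^ 2 * x) 1)) := by
  have := boxFilter_neBot hx
  have hm := min_mul_mem_Icc hx.1
  have h1 := (hP _ hm).comp (tendsto_boxFilter_shift x)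
  refine tendsto_nhds_unique (hP x hx) (Tendsto.congr' ?_
    (h1.div (h1.const_add 1) (by linarith [(hP.mem_Icc hm).1])))
  filter_upwards [eventually_boxQuot_shift hxφ] with p hp using hp.symm

theorem inv_sq_mul (hP : IsBoxLimit P) {x : ℝ} (hx : x ∈ Set.Icc (0 : ℝ) 1) :
    P ((φ ^ 2)⁻¹ * x) = fareyLeft (P x) := by
  have h0 : (0 : ℝ) < (φ ^ 2)⁻¹ := by positivity
  have h1 : (φ ^ 2)⁻¹ * x ≤ (φ ^ 2)⁻¹ := mul_le_of_le_one_right h0.le hx.2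
  rw [hP.eq_fareyLeft ⟨mul_nonneg h0.le hx.1, by
    linarith [inv_goldenRatio_add_sq, inv_goldenRatio_sq_lt]⟩
    (h1.trans_lt inv_goldenRatio_sq_lt), mul_inv_cancel_left₀ (by positivity), min_eq_left hx.2]

theorem map_zero (hP : IsBoxLimit P) : P 0 = 0 := by
  have h := hP.inv_sq_mul (x := 0) (by simp)
  have h0 := (hP.mem_Icc (x := 0) (by simp)).1
  rw [mul_zero, fareyLeft, eq_div_iff (by linarith)] at h
  nlinarith

theorem map_one (hP : IsBoxLimit P) : P 1 = 1 := by
  have h := hP.one_sub (x := 0) (by simp)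
  rwa [sub_zero, hP.map_zero, sub_zero] at h

theorem monotoneOn (hP : IsBoxLimit P) : MonotoneOn P (Set.Icc 0 1) := by
  -- the largest violation of monotonicity shrinks under the symmetries, like the oscillation
  have key : ∀ ε > 0, ∀ x ∈ Set.Icc (0 : ℝ) 1, ∀ y ∈ Set.Icc (0 : ℝ) 1, x ≤ y → P x - P y ≤ ε := by
    intro ε hε
    suffices h : ∃ d, d < ε ∧ ∀ x ∈ Set.Icc (0 : ℝ) 1, ∀ y ∈ Set.Icc (0 : ℝ) 1,
        x ≤ y → P x - P y ≤ d by
      obtain ⟨d, hdε, hd⟩ := h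
      exact fun x hx y hy hxy => (hd x hx y hy hxy).trans hdε.le
    refine fareyLeft_induction ?_ ?_ hε
    · intro x hx y hy _
      linarith [(hP.mem_Icc hx).2, (hP.mem_Icc hy).1]
    · intro d hd0 hd
      have left : ∀ x ∈ Set.Icc (0 : ℝ) 1, ∀ y ∈ Set.Icc (0 : ℝ) 1, x ≤ y → y < φ⁻¹ →
          P x - P y ≤ fareyLeft d := by
        intro x hx y hy hxy hyφ
        have hmx := min_mul_mem_Icc hx.1
        have hmy := min_mul_mem_Icc hy.1
        rw [hP.eq_fareyLeft hx (hxy.trans_lt hyφ), hP.eq_fareyLeft hy hyφ]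
        exact fareyLeft_sub_le (hP.mem_Icc hmx).1 (hP.mem_Icc hmy).1 hd0
          (hd _ hmx _ hmy (min_le_min_right _ (mul_le_mul_of_nonneg_left hxy (by positivity))))
      have half : ∀ x ∈ Set.Icc (0 : ℝ) 1, x < φ⁻¹ → P x ≤ 1 / 2 := by
        intro x hx hxφ
        have hm := hP.mem_Icc (min_mul_mem_Icc hx.1)
        rw [hP.eq_fareyLeft hx hxφ, fareyLeft, div_le_div_iff₀ (by linarith [hm.1]) (by norm_num)]
        linarith [hm.2]
      have hφ := inv_goldenRatio_add_sq
      have hφ' := inv_goldenRatio_sq_lt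
      intro x hx y hy hxy
      have hx' : 1 - x ∈ Set.Icc (0 : ℝ) 1 := ⟨by linarith [hx.2], by linarith [hx.1]⟩
      have hy' : 1 - y ∈ Set.Icc (0 : ℝ) 1 := ⟨by linarith [hy.2], by linarith [hy.1]⟩
      rcases lt_or_ge y φ⁻¹ with h | h
      · exact left x hx y hy hxy h
      · rcases lt_or_ge x φ⁻¹ with h2 | h2
        · have h3 := half x hx h2
          have h4 := half (1 - y) hy' (by linarith)
          rw [hP.one_sub hy] at h4
          have : 0 ≤ fareyLeft d := by unfold fareyLeft; positivity
          linarith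
        · have h3 := left (1 - y) hy' (1 - x) hx' (by linarith) (by linarith)
          rw [hP.one_sub hy, hP.one_sub hx] at h3
          linarith
  intro x hx y hy hxy
  have := le_of_forall_pos_le_add (a := P x - P y) (b := 0) fun ε hε => by
    rw [zero_add]
    exact key ε hε x hx y hy hxy
  linarith

theorem inv_sq_pow_mul (hP : IsBoxLimit P) {x : ℝ} (hx : x ∈ Set.Icc (0 : ℝ) 1) (n : ℕ) :
    P ((φ ^ 2)⁻¹ ^ n * x) = P x / (1 + n * P x) := by
  have h0 := (hP.mem_Icc hx).1
  have ha : (φ ^ 2)⁻¹ ≤ 1 := inv_le_one_of_one_le₀ (one_le_pow₀ Real.one_lt_goldenRatio.le)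
  induction n with
  | zero => simp
  | succ n ih =>
    rw [pow_succ', mul_assoc, hP.inv_sq_mul ⟨mul_nonneg (by positivity) hx.1,
      mul_le_one₀ (pow_le_one₀ (by positivity) ha) hx.1 hx.2⟩, ih, fareyLeft]
    have : 0 < 1 + n * P x := by positivity
    have : 0 < 1 + (n + 1) * P x := by positivity
    push_cast
    field_simp
    ring

/-- The limit function conjugates an inverse branch of a piecewise affine map to the inverse branch
`y ↦ 1 / (n + 1 + y)` of the Gauss map. -/
theorem gauss_branch (hP : IsBoxLimit P) {x : ℝ} (hx : x ∈ Set.Icc (0 : ℝ) 1) (n : ℕ) :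
    P ((φ ^ 2)⁻¹ ^ n * (1 - (φ ^ 2)⁻¹ * x)) = 1 / (n + 1 + P x) := by
  have ha : (φ ^ 2)⁻¹ ≤ 1 := inv_le_one_of_one_le₀ (one_le_pow₀ Real.one_lt_goldenRatio.le)
  have h0 := (hP.mem_Icc hx).1
  have hm : (φ ^ 2)⁻¹ * x ∈ Set.Icc (0 : ℝ) 1 :=
    ⟨mul_nonneg (by positivity) hx.1, mul_le_one₀ ha hx.1 hx.2⟩
  rw [hP.inv_sq_pow_mul ⟨by linarith [hm.2], by linarith [hm.1]⟩, hP.one_sub hm, hP.inv_sq_mul hx,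
    fareyLeft]
  have e : 1 - P x / (1 + P x) = 1 / (1 + P x) := by
    field_simp
    ring
  rw [e]
  field_simp
  ring

/-- Points with values strictly between `1 / (n + 2)` and `1 / (n + 1)` lie in the range of the
`n`-th branch. -/
theorem exists_gauss_branch (hP : IsBoxLimit P) {s : ℝ} (hs : s ∈ Set.Icc (0 : ℝ) 1) {n : ℕ}
    (h1 : 1 / ((n : ℝ) + 2) < P s) (h2 : P s < 1 / ((n : ℝ) + 1)) :
    ∃ x ∈ Set.Icc (0 : ℝ) 1, s = (φ ^ 2)⁻¹ ^ n * (1 - (φ ^ 2)⁻¹ * x) ∧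
      P x = (P s)⁻¹ - (n + 1) := by
  have ha0 : (0 : ℝ) < (φ ^ 2)⁻¹ := by positivity
  have ha1 : (φ ^ 2)⁻¹ ≤ 1 := inv_le_one_of_one_le₀ (one_le_pow₀ Real.one_lt_goldenRatio.le)
  have hb0 := hP.gauss_branch (x := 0) (by simp) n
  have hb1 := hP.gauss_branch (x := 1) (by simp) n
  rw [hP.map_zero, mul_zero, sub_zero, mul_one, add_zero] at hb0
  rw [hP.map_one, mul_one, add_assoc, one_add_one_eq_two] at hb1
  have hb := fun x hx => hP.gauss_branch (x := x) hx n
  generalize (φ ^ 2)⁻¹ = a at *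
  have hn0 : 0 < a ^ n := by positivity
  have hn1 : a ^ n ≤ 1 := pow_le_one₀ ha0.le ha1
  have hlt : s < a ^ n := by
    by_contra! h
    have := hP.monotoneOn ⟨hn0.le, hn1⟩ hs h
    linarith
  have hgt : a ^ n * (1 - a) < s := by
    by_contra! h
    have := hP.monotoneOn hs ⟨mul_nonneg hn0.le (by linarith), by nlinarith⟩ h
    linarith
  have hx : (1 - s / a ^ n) / a ∈ Set.Icc (0 : ℝ) 1 := by
    constructor
    · exact div_nonneg (sub_nonneg.2 ((div_le_one hn0).2 hlt.le)) ha0.le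
    · rw [div_le_one ha0, sub_le_comm, le_div_iff₀ hn0]
      linarith
  have hsx : s = a ^ n * (1 - a * ((1 - s / a ^ n) / a)) := by
    field_simp
    ring
  refine ⟨_, hx, hsx, ?_⟩
  rw [hsx, hb _ hx, one_div, inv_inv, add_sub_cancel_left, ← hsx]

end IsBoxLimit

/-! ### Continued fraction digits -/

/-- The continued fraction digits of `x ∈ (0, 1)`, read off from the orbit of `x` under the Gauss
map `x ↦ fract x⁻¹`. -/
noncomputable def gaussDigit : ℝ → ℕ → ℕ
  | x, 0 => ⌊x⁻¹⌋₊
  | x, n + 1 => gaussDigit (Int.fract x⁻¹) n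

theorem Irrational.fract_mem_Ioo {x : ℝ} (hx : Irrational x) :
    Irrational (Int.fract x) ∧ Int.fract x ∈ Set.Ioo (0 : ℝ) 1 := by
  have h : Irrational (Int.fract x) := by
    rw [← Int.self_sub_floor]
    exact hx.sub_intCast _
  exact ⟨h, (Int.fract_nonneg x).lt_of_ne' h.ne_zero, Int.fract_lt_one x⟩

theorem one_le_gaussDigit {x : ℝ} (hx : Irrational x) (hx1 : x ∈ Set.Ioo (0 : ℝ) 1) (n : ℕ) :
    1 ≤ gaussDigit x n := by
  induction n generalizing x with
  | zero => exact Nat.le_floor (by simpa using (one_le_inv₀ hx1.1).2 hx1.2.le)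
  | succ n ih =>
    obtain ⟨h1, h2⟩ := hx.inv.fract_mem_Ioo
    exact ih h1 h2

theorem GenContFract.of_fract_s_get? (x : ℝ) (hx : Int.fract x ≠ 0) (n : ℕ) :
    (GenContFract.of (Int.fract x)).s.get? n = (GenContFract.of x).s.get? n := by
  cases n with
  | zero =>
    have h1 := GenContFract.of_s_head hx
    have h2 := GenContFract.of_s_head (v := Int.fract x) (by rwa [Int.fract_fract])
    rw [Int.fract_fract] at h2
    exact h2.trans h1.symm
  | succ n => rw [GenContFract.of_s_succ, GenContFract.of_s_succ, Int.fract_fract]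

theorem of_s_get?_eq_gaussDigit {x : ℝ} (hx : Irrational x) (hx1 : x ∈ Set.Ioo (0 : ℝ) 1) (n : ℕ) :
    (GenContFract.of x).s.get? n = some ⟨1, gaussDigit x n⟩ := by
  have hf : Int.fract x = x := Int.fract_eq_self.2 ⟨hx1.1.le, hx1.2⟩
  induction n generalizing x with
  | zero =>
    have h := GenContFract.of_s_head (v := x) (by rw [hf]; exact hx1.1.ne')
    rw [hf] at h
    refine h.trans ?_
    rw [gaussDigit, natCast_floor_eq_intCast_floor (inv_nonneg.2 hx1.1.le)]
  | succ n ih =>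
    obtain ⟨h1, h2⟩ := hx.inv.fract_mem_Ioo
    rw [GenContFract.of_s_succ, hf, ← GenContFract.of_fract_s_get? _ h2.1.ne',
      ih h1 h2 (Int.fract_fract _), gaussDigit]

theorem hasContFrac_gaussDigit {x : ℝ} (hx : Irrational x) (hx1 : x ∈ Set.Ioo (0 : ℝ) 1) :
    HasContFrac x (gaussDigit x) := by
  refine ⟨?_, fun i => ⟨one_le_gaussDigit hx hx1 i, ?_⟩⟩
  · rw [GenContFract.of_h_eq_floor, Int.floor_eq_zero_iff.2 ⟨hx1.1.le, hx1.2⟩, Int.cast_zero]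
  · exact GenContFract.partDen_eq_s_b (of_s_get?_eq_gaussDigit hx hx1 i)

/-! ### The series -/

theorem abs_boxInvTerm_le {c : ℕ → ℕ} (hc : ∀ i, 1 ≤ c i) (j : ℕ) :
    ‖boxInvTerm c j‖ ≤ φ⁻¹ * (φ ^ 2)⁻¹ ^ j := by
  have hsum : ((j : ℤ) + 1) ≤ ∑ i ∈ Finset.range (j + 1), (c i : ℤ) := by
    have := Finset.card_nsmul_le_sum (Finset.range (j + 1)) (fun i => (c i : ℤ)) 1
      fun i _ => by exact_mod_cast hc i
    simpa using this
  have e : φ⁻¹ * (φ ^ 2)⁻¹ ^ j = φ ^ (-(2 * ((j : ℤ) + 1) - 1)) := by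
    rw [← inv_pow, ← pow_mul, ← pow_succ', ← zpow_natCast, inv_zpow, ← zpow_neg]
    congr 1
    push_cast
    ring
  rw [boxInvTerm, norm_mul, norm_pow, norm_neg, norm_one, one_pow, one_mul, e,
    Real.norm_of_nonneg (by positivity)]
  exact zpow_le_zpow_right₀ Real.one_lt_goldenRatio.le (by linarith)

theorem inv_sq_lt_one : (φ ^ 2)⁻¹ < 1 :=
  inv_lt_one_of_one_lt₀ (one_lt_pow₀ Real.one_lt_goldenRatio two_ne_zero)

theorem hasSum_geometric_bound :
    HasSum (fun j => φ⁻¹ * (φ ^ 2)⁻¹ ^ j) (φ⁻¹ * (1 - (φ ^ 2)⁻¹)⁻¹) :=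
  (hasSum_geometric_of_lt_one (by positivity) inv_sq_lt_one).mul_left _

theorem summable_boxInvTerm {c : ℕ → ℕ} (hc : ∀ i, 1 ≤ c i) : Summable (boxInvTerm c) :=
  Summable.of_norm_bounded hasSum_geometric_bound.summable (abs_boxInvTerm_le hc)

theorem boxInvTerm_zero (c : ℕ → ℕ) {n : ℕ} (hn : c 0 = n + 1) :
    φ * boxInvTerm c 0 = (φ ^ 2)⁻¹ ^ n := by
  have h0 := Real.goldenRatio_ne_zero
  rw [boxInvTerm, ← inv_pow, ← pow_mul, ← zpow_natCast φ⁻¹, inv_zpow, ← zpow_neg]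
  simp only [zero_add, Finset.range_one, Finset.sum_singleton, hn, even_two, Even.neg_pow,
    one_pow, one_mul]
  rw [← zpow_one_add₀ h0]
  congr 1
  push_cast
  ring

theorem boxInvTerm_succ (c : ℕ → ℕ) {n : ℕ} (hn : c 0 = n + 1) (j : ℕ) :
    boxInvTerm c (j + 1) = -((φ ^ 2)⁻¹ ^ (n + 1) * boxInvTerm (fun i => c (i + 1)) j) := by
  have h0 := Real.goldenRatio_ne_zero
  rw [boxInvTerm, boxInvTerm, Finset.sum_range_succ', hn, ← inv_pow, ← pow_mul,
    ← zpow_natCast φ⁻¹, inv_zpow, ← zpow_neg, mul_left_comm, ← zpow_add₀ h0, ← neg_mul, pow_succ,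
    mul_neg_one]
  congr 2
  push_cast
  ring

/-- The series satisfies the recursion that inverts `IsBoxLimit.gauss_branch`. -/
theorem tsum_boxInvTerm {c : ℕ → ℕ} (hc : ∀ i, 1 ≤ c i) {n : ℕ} (hn : c 0 = n + 1) :
    φ * ∑' j, boxInvTerm c j =
      (φ ^ 2)⁻¹ ^ n * (1 - (φ ^ 2)⁻¹ * (φ * ∑' j, boxInvTerm (fun i => c (i + 1)) j)) := by
  rw [(summable_boxInvTerm hc).tsum_eq_zero_add, mul_add, boxInvTerm_zero c hn]
  simp_rw [boxInvTerm_succ c hn]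
  rw [tsum_neg, tsum_mul_left]
  ring

theorem IsBoxLimit.eq_tsum_boxInvTerm {P : ℝ → ℝ} (hP : IsBoxLimit P) {s : ℝ}
    (hs : s ∈ Set.Icc (0 : ℝ) 1) (hirr : Irrational (P s)) :
    s = φ * ∑' j, boxInvTerm (gaussDigit (P s)) j := by
  have hIoo : ∀ s ∈ Set.Icc (0 : ℝ) 1, Irrational (P s) → P s ∈ Set.Ioo (0 : ℝ) 1 :=
    fun s hs h => ⟨(hP.mem_Icc hs).1.lt_of_ne' h.ne_zero, (hP.mem_Icc hs).2.lt_of_ne h.ne_one⟩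
  -- unwinding `n` digits brings `s` and the sum within distance of order `φ ^ (-2 * n)`
  have key : ∀ n : ℕ, ∀ s ∈ Set.Icc (0 : ℝ) 1, Irrational (P s) →
      |s - φ * ∑' j, boxInvTerm (gaussDigit (P s)) j| ≤
        (1 + φ * (φ⁻¹ * (1 - (φ ^ 2)⁻¹)⁻¹)) * (φ ^ 2)⁻¹ ^ n := by
    intro n
    induction n with
    | zero =>
      intro s hs h
      have h1 := tsum_of_norm_bounded hasSum_geometric_bound
        (abs_boxInvTerm_le (one_le_gaussDigit h (hIoo s hs h)))
      rw [Real.norm_eq_abs] at h1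
      rw [pow_zero, mul_one]
      refine (abs_sub _ _).trans (add_le_add (abs_le.2 ⟨by linarith [hs.1], hs.2⟩) ?_)
      rw [abs_mul, abs_of_pos Real.goldenRatio_pos]
      exact mul_le_mul_of_nonneg_left h1 Real.goldenRatio_pos.le
    | succ n ih =>
      intro s hs h
      have hx := hIoo s hs h
      have hc := one_le_gaussDigit h hx
      obtain ⟨m, hm⟩ := Nat.exists_eq_add_of_le' (hc 0)
      have hfl : ⌊(P s)⁻¹⌋ = (m : ℤ) + 1 := by
        rw [← Int.natCast_floor_eq_floor (inv_nonneg.2 hx.1.le)]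
        exact_mod_cast hm
      have hfl2 := Int.floor_eq_iff.1 hfl
      push_cast at hfl2
      have hne : (P s)⁻¹ ≠ (m : ℝ) + 1 := fun e => h.inv ⟨(m : ℚ) + 1, by rw [e]; push_cast; rfl⟩
      have hm0 : (0 : ℝ) < (m : ℝ) + 1 := by positivity
      obtain ⟨t, ht, hst, htx⟩ := hP.exists_gauss_branch (n := m) hs
        (by
          rw [one_div, inv_lt_comm₀ (by positivity) hx.1]
          linarith [hfl2.2])
        (by
          rw [one_div, lt_inv_comm₀ hx.1 hm0]
          exact hfl2.1.lt_of_ne' hne)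
      have hfr : P t = Int.fract (P s)⁻¹ := by
        rw [htx, ← Int.self_sub_floor, hfl]
        push_cast
        rfl
      have hti : Irrational (P t) := hfr ▸ h.inv.fract_mem_Ioo.1
      have hsum := tsum_boxInvTerm hc hm
      have hd : (fun i => gaussDigit (P s) (i + 1)) = gaussDigit (P t) := by
        rw [hfr]
        rfl
      rw [hd] at hsum
      have hi := ih t ht hti
      have e : s - φ * ∑' j, boxInvTerm (gaussDigit (P s)) j = -((φ ^ 2)⁻¹ ^ m * ((φ ^ 2)⁻¹ *
          (t - φ * ∑' j, boxInvTerm (gaussDigit (P t)) j))) := by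
        rw [hsum]
        nth_rewrite 1 [hst]
        ring
      have hm1 : (φ ^ 2)⁻¹ ^ m ≤ 1 := pow_le_one₀ (by positivity) inv_sq_lt_one.le
      rw [e, abs_neg, abs_mul, abs_mul, abs_of_pos (by positivity), abs_of_pos (by positivity),
        pow_succ' (φ ^ 2)⁻¹ n, mul_left_comm (_ + _)]
      exact (mul_le_of_le_one_left (by positivity) hm1).trans
        (mul_le_mul_of_nonneg_left hi (by positivity))
  have hlim := (tendsto_pow_atTop_nhds_zero_of_lt_one (by positivity) inv_sq_lt_one).const_mul
    (1 + φ * (φ⁻¹ * (1 - (φ ^ 2)⁻¹)⁻¹))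
  rw [mul_zero] at hlim
  exact sub_eq_zero.1 (abs_nonpos_iff.1 (ge_of_tendsto' hlim fun n => key n s hs hirr))

/-! ### The box function -/

theorem goldenRatio_mul_mem_Icc {t : ℝ} (ht : t ∈ Set.Icc (0 : ℝ) (1 / φ)) :
    φ * t ∈ Set.Icc (0 : ℝ) 1 := by
  refine ⟨mul_nonneg Real.goldenRatio_pos.le ht.1, ?_⟩
  rw [mul_comm, ← le_div_iff₀ Real.goldenRatio_pos]
  exact ht.2

theorem IsBoxLimit.isFibBoxFunction {P : ℝ → ℝ} (hP : IsBoxLimit P) :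
    IsFibBoxFunction fun t => P (φ * t) := by
  intro t ht k hk hkt
  have hf : Tendsto (fun n => (n - 1, k n + 1)) atTop (boxFilter (φ * t)) := by
    refine tendsto_boxFilter_iff.2 ⟨tendsto_sub_atTop_nat 1, hk, ?_⟩
    have h1 := (tendsto_fib_pred_div_fib.inv₀ (inv_ne_zero Real.goldenRatio_ne_zero)).mul
      (hkt.add (tendsto_inv_atTop_zero.comp tendsto_cast_fib_atTop))
    rw [inv_inv, add_zero] at h1
    refine h1.congr' ?_
    filter_upwards [eventually_ge_atTop 2] with n hn
    have h2 : (0 : ℝ) < Nat.fib n := Nat.cast_pos.2 (Nat.fib_pos.2 (by omega))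
    have h3 : (0 : ℝ) < Nat.fib (n - 1) := Nat.cast_pos.2 (Nat.fib_pos.2 (by omega))
    rw [Function.comp_apply]
    push_cast
    field_simp
  refine ((hP _ (goldenRatio_mul_mem_Icc ht)).comp hf).congr' ?_
  filter_upwards [eventually_ge_atTop 1] with n hn
  obtain ⟨m, rfl⟩ := Nat.exists_eq_add_of_le' hn
  exact (fibRepQuot_succ m (k (m + 1))).symm

/-- Every point of `[0, 1/φ]` is a limit of admissible quotients, so a box function is unique
there. -/
theorem IsFibBoxFunction.eqOn {Q Q' : ℝ → ℝ} (hQ : IsFibBoxFunction Q) (hQ' : IsFibBoxFunction Q') :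
    Set.EqOn Q Q' (Set.Icc 0 (1 / φ)) := by
  intro t ht
  have hx := goldenRatio_mul_mem_Icc ht
  -- the predecessor keeps the sequence admissible at `t = 1/φ`
  let k : ℕ → ℕ := fun n => ⌊φ * t * Nat.fib (n - 1)⌋₊ - 1
  have hk : ∀ᶠ n in atTop, k n < Nat.fib (n - 1) := by
    filter_upwards [eventually_ge_atTop 2] with n hn
    have h1 := floor_mul_fib_le hx.2 (n - 1)
    have h2 : 0 < Nat.fib (n - 1) := Nat.fib_pos.2 (by omega)
    simp only [k]
    omega
  have hf := (tendsto_floor_mul_fib hx.1).comp (tendsto_sub_atTop_nat 1)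
  have hinv := tendsto_inv_atTop_zero.comp tendsto_cast_fib_atTop
  have hkt : Tendsto (fun n => (k n : ℝ) / (Nat.fib n : ℝ)) atTop (𝓝 t) := by
    have h1 : Tendsto (fun n => (⌊φ * t * Nat.fib (n - 1)⌋₊ : ℝ) / (Nat.fib n : ℝ)) atTop
        (𝓝 t) := by
      have h := hf.mul tendsto_fib_pred_div_fib
      rw [mul_right_comm, mul_inv_cancel₀ Real.goldenRatio_ne_zero, one_mul] at h
      refine h.congr' ?_
      filter_upwards [eventually_ge_atTop 2] with n hn
      have h3 : (0 : ℝ) < Nat.fib (n - 1) := Nat.cast_pos.2 (Nat.fib_pos.2 (by omega))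
      exact div_mul_div_cancel₀ h3.ne'
    have h2 := h1.sub hinv
    rw [sub_zero] at h2
    refine tendsto_of_tendsto_of_tendsto_of_le_of_le h2 h1 (fun n => ?_) (fun n => ?_)
    · simp only [Function.comp_apply, k]
      rw [← one_div, ← sub_div]
      refine div_le_div_of_nonneg_right ?_ (Nat.cast_nonneg _)
      rw [sub_le_iff_le_add]
      exact_mod_cast le_tsub_add
    · exact div_le_div_of_nonneg_right (Nat.cast_le.2 (Nat.sub_le _ _)) (Nat.cast_nonneg _)
  exact tendsto_nhds_unique (hQ t ht k hk hkt) (hQ' t ht k hk hkt)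

theorem theorem4p8 :
    (∃ Q : ℝ → ℝ, IsFibBoxFunction Q) ∧
    ∀ Q : ℝ → ℝ, IsFibBoxFunction Q →
      MonotoneOn Q (Set.Icc 0 (1 / Real.goldenRatio)) ∧
      ContinuousOn Q (Set.Icc 0 (1 / Real.goldenRatio)) ∧
      Q '' Set.Icc 0 (1 / Real.goldenRatio) = Set.Icc 0 1 ∧
      ∀ x ∈ Set.Icc (0 : ℝ) 1, Irrational x →
        ∃ c : ℕ → ℕ, HasContFrac x c ∧
          ∃ S : ℝ, HasSum (boxInvTerm c) S ∧
            {t ∈ Set.Icc 0 (1 / Real.goldenRatio) | Q t = x} = {S} ∧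
            ∀ G : ℝ → ℝ, IsInverseOfBox Q G →
              ContinuousWithinAt G (Set.Icc 0 1) x ∧ G x = S := by
  obtain ⟨P, hP⟩ := exists_isBoxLimit
  refine ⟨⟨_, hP.isFibBoxFunction⟩, fun Q hQ => ?_⟩
  have hQP : Set.EqOn Q (fun t => P (φ * t)) (Set.Icc 0 (1 / φ)) := hQ.eqOn hP.isFibBoxFunction
  have hmono : MonotoneOn Q (Set.Icc 0 (1 / φ)) := fun s hs t ht hst => by
    rw [hQP hs, hQP ht]
    exact hP.monotoneOn (goldenRatio_mul_mem_Icc hs) (goldenRatio_mul_mem_Icc ht)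
      (mul_le_mul_of_nonneg_left hst Real.goldenRatio_pos.le)
  have hcont : ContinuousOn Q (Set.Icc 0 (1 / φ)) :=
    (hP.continuousOn.comp (continuousOn_const.mul continuousOn_id)
      fun t ht => goldenRatio_mul_mem_Icc ht).congr hQP
  have himage : Q '' Set.Icc 0 (1 / φ) = Set.Icc 0 1 := by
    refine Set.Subset.antisymm ?_ ?_
    · rintro _ ⟨t, ht, rfl⟩
      rw [hQP ht]
      exact hP.mem_Icc (goldenRatio_mul_mem_Icc ht)
    · have h0 : Q 0 = 0 := by
        rw [hQP ⟨le_rfl, by positivity⟩]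
        simp only [mul_zero, hP.map_zero]
      have h1 : Q (1 / φ) = 1 := by
        rw [hQP ⟨by positivity, le_rfl⟩]
        simp only [mul_one_div_cancel Real.goldenRatio_ne_zero, hP.map_one]
      have h := intermediate_value_Icc (show (0 : ℝ) ≤ 1 / φ by positivity) hcont
      rwa [h0, h1] at h
  refine ⟨hmono, hcont, himage, fun x hx hirr => ?_⟩
  have hx1 : x ∈ Set.Ioo (0 : ℝ) 1 :=
    ⟨hx.1.lt_of_ne' hirr.ne_zero, hx.2.lt_of_ne hirr.ne_one⟩
  have huniq : ∀ t ∈ Set.Icc 0 (1 / φ), Q t = x → t = ∑' j, boxInvTerm (gaussDigit x) j := by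
    intro t ht htx
    rw [hQP ht] at htx
    have h := hP.eq_tsum_boxInvTerm (goldenRatio_mul_mem_Icc ht) (by
      simp only at htx
      rwa [htx])
    simp only at htx
    rw [htx] at h
    exact mul_left_cancel₀ Real.goldenRatio_ne_zero h
  refine ⟨gaussDigit x, hasContFrac_gaussDigit hirr hx1, _,
    (summable_boxInvTerm (one_le_gaussDigit hirr hx1)).hasSum, ?_, fun G hG => ?_⟩
  · obtain ⟨t, ht, htx⟩ : x ∈ Q '' Set.Icc 0 (1 / φ) := himage ▸ hx
    refine Set.eq_singleton_iff_unique_mem.2 ⟨?_, fun s hs => huniq s hs.1 hs.2⟩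
    rw [← huniq t ht htx]
    exact ⟨ht, htx⟩
  · have hGx := huniq (G x) (hG.1 hx) (hG.2 hx)
    refine ⟨?_, hGx⟩
    -- a cluster point of `G` at `x` is a preimage of `x`, because `Q` is continuous
    refine isCompact_Icc.tendsto_nhds_of_unique_mapClusterPt
      (eventually_mem_nhdsWithin.mono fun y hy => hG.1 hy) fun t ht hclus => ?_
    rw [hGx]
    refine huniq t ht ?_
    obtain ⟨U, hU, hUt⟩ := mapClusterPt_iff_ultrafilter.1 hclus
    have hUmem : ∀ᶠ y in (U : Filter ℝ), y ∈ Set.Icc (0 : ℝ) 1 := hU self_mem_nhdsWithin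
    have h1 : Tendsto (fun y => Q (G y)) U (𝓝 (Q t)) :=
      (hcont t ht).tendsto.comp (tendsto_nhdsWithin_iff.2 ⟨hUt, hUmem.mono fun y hy => hG.1 hy⟩)
    have h2 : Tendsto (fun y => Q (G y)) U (𝓝 x) :=
      (tendsto_id'.2 (hU.trans nhdsWithin_le_nhds)).congr' (hUmem.mono fun y hy => (hG.2 hy).symm)
    exact tendsto_nhds_unique h1 h2
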